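/- Let $(R,\mathfrak m,k)$ be a complete Noetherian Cohen--Macaulay local ring. Let $\mathrm{CM}(R)$ be the category of maximal Cohen--Macaulay (MCM) $R$-modules, that is, finitely generated $R$-modules $M$ with $\mathrm{Ext}^i_R(k,M)=0$ for all $i<\dim R$, and let $\underline{\mathrm{CM}}(R)$ be its stable category, with the same objects and with $\underline{\mathrm{Hom}}_R(M,N)=\mathrm{Hom}_R(M,N)/\{\text{maps factoring through a finitely generated free module}\}$. Let $\mathrm{mod}\,\underline{\mathrm{CM}}(R)$ be the category of finitely presented contravariant additive functors from $\underline{\mathrm{CM}}(R)$ to abelian groups, i.e. those $F$ with an exact sequence $\underline{\mathrm{Hom}}_R(-,B)\to\underline{\mathrm{Hom}}_R(-,A)\to F\to 0$, $A,B\in \mathrm{CM}(R)$. Let $\mathsf{Sp}\,\mathrm{CM}(R)$ be the set of isomorphism classes of indecomposable (nonzero) MCM modules not isomorphic to $R$. For $\mathcal X\subseteq \mathsf{Sp}\,\mathrm{CM}(R)$ put $\Sigma(\mathcal X)=\{F\in\mathrm{mod}\,\underline{\mathrm{CM}}(R) : F(X)=0 \text{ for all } X\in\mathcal X\}$, and for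 a class $\mathcal F$ of objects of $\mathrm{mod}\,\underline{\mathrm{CM}}(R)$ put $\gamma(\mathcal F)=\{M\in \mathsf{Sp}\,\mathrm{CM}(R) : F(M)=0\text{ for all }F\in\mathcal F\}$. The sets $\mathcal X$ with $\gamma(\Sigma(\mathcal X))=\mathcal X$ are the closed sets of a topology on $\mathsf{Sp}\,\mathrm{CM}(R)$; equip $\mathsf{Sp}\,\mathrm{CM}(R)$ with it. Let $M\in\mathsf{Sp}\,\mathrm{CM}(R)$. Then $M$ is an isolated point, i.e. $\{M\}$ is open, if and only if there is an Auslander--Reiten sequence ending in $M$, that is, a non-split short exact sequence $0\to N\to E\xrightarrow{p} M\to 0$ of MCM modules with $N$ indecomposable, such that every homomorphism $q:L\to M$ with $L$ MCM which is not a split epimorphism factors through $p$. -/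

import Mathlib

universe u
open CategoryTheory CategoryTheory.Limits IsLocalRing Opposite

namespace MCM

section
variable (R : Type u) [CommRing R] [IsLocalRing R]

/-- Maximal Cohen-Macaulay modules: finitely generated modules `M` with `Ext^i(k, M) = 0` for all
`i < dim R`, where `k` is the residue field. -/
def IsMCM : ObjectProperty (ModuleCat.{u} R) := fun M =>
  Module.Finite R M ∧ ∀ i : ℕ, (i : WithBot ℕ∞) < ringKrullDim R →
    Subsingleton (Abelian.Ext (ModuleCat.of R (ResidueField R)) M i)

/-- The local ring `R` is Cohen-Macaulay: `R` is maximal Cohen-Macaulay over itself. -/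
class IsCohenMacaulay : Prop where
  isMCM_self : IsMCM R (ModuleCat.of R R)

/-- The full subcategory of maximal Cohen-Macaulay modules. -/
abbrev CM := (IsMCM R).FullSubcategory

/-- Two morphisms are identified when their difference factors through a free module. -/
def stableRel : HomRel (CM R) := fun M N f g =>
  ∃ (P : ModuleCat.{u} R) (_ : Module.Finite R P) (_ : Module.Free R P)
    (a : M.obj ⟶ P) (b : P ⟶ N.obj), f.hom - g.hom = a ≫ b

variable {R} in
theorem stableRel_add ⦃M N : CM R⦄ (f₁ f₂ g₁ g₂ : M ⟶ N) (hf : stableRel R f₁ f₂)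
    (hg : stableRel R g₁ g₂) : stableRel R (f₁ + g₁) (f₂ + g₂) := by
  obtain ⟨P, _, _, a, b, h⟩ := hf
  obtain ⟨Q, _, _, c, d, k⟩ := hg
  refine ⟨ModuleCat.of R (P × Q), inferInstanceAs (Module.Finite R (P × Q)),
    inferInstanceAs (Module.Free R (P × Q)), ModuleCat.ofHom (a.hom.prod c.hom),
    ModuleCat.ofHom (b.hom.coprod d.hom), ?_⟩
  have : (f₁ + g₁).hom - (f₂ + g₂).hom = (f₁.hom - f₂.hom) + (g₁.hom - g₂.hom) := by
    change f₁.hom + g₁.hom - (f₂.hom + g₂.hom) = _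
    abel
  rw [this, h, k]
  ext x
  simp

instance : Congruence (stableRel R) where
  comp_left f _ _ h := by
    obtain ⟨P, _, _, a, b, h⟩ := h
    refine ⟨P, ‹_›, ‹_›, f.hom ≫ a, b, ?_⟩
    rw [Category.assoc, ← h, Preadditive.comp_sub]
    rfl
  comp_right g h := by
    obtain ⟨P, _, _, a, b, h⟩ := h
    refine ⟨P, ‹_›, ‹_›, a, b ≫ g.hom, ?_⟩
    rw [← Category.assoc, ← h, Preadditive.sub_comp]
    rfl
  equivalence :=
    { refl f := ⟨ModuleCat.of R PUnit.{u+1}, inferInstanceAs (Module.Finite R PUnit.{u+1}),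
        inferInstanceAs (Module.Free R PUnit.{u+1}), 0, 0, by simp⟩
      symm := by
        rintro f g ⟨P, _, _, a, b, h⟩
        exact ⟨P, ‹_›, ‹_›, a, -b, by rw [Preadditive.comp_neg, ← h, neg_sub]⟩
      trans := by
        intro f g h hfg hgh
        obtain ⟨P, i, j, a, b, e⟩ := stableRel_add _ _ _ _ hfg hgh
        refine ⟨P, i, j, a, b, ?_⟩
        rw [← e]
        change f.hom - h.hom = f.hom + g.hom - (g.hom + h.hom)
        abel }

/-- The stable category of `CM R`. -/
abbrev StableCM := CategoryTheory.Quotient (stableRel R)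

noncomputable instance : Preadditive (StableCM R) :=
  CategoryTheory.Quotient.preadditive _ stableRel_add

/-- The projection `CM R ⥤ StableCM R`. -/
def stableFunctor : CM R ⥤ StableCM R := CategoryTheory.Quotient.functor (stableRel R)

/-- Finitely presented contravariant additive functors `F` on the stable category: there is an
exact sequence `Hom(-, B) ⟶ Hom(-, A) ⟶ F ⟶ 0` (exactness of functors is pointwise). -/
def IsFinPres : ObjectProperty ((StableCM R)ᵒᵖ ⥤ AddCommGrpCat.{u}) := fun F =>
  F.Additive ∧ ∃ (B A : StableCM R) (f : B ⟶ A) (π : preadditiveYoneda.obj A ⟶ F),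
    ∀ X : (StableCM R)ᵒᵖ, Function.Exact ((preadditiveYoneda.map f).app X) (π.app X) ∧
      Function.Surjective (π.app X)

/-- The category of finitely presented functors on the stable category. -/
abbrev ModStable := (IsFinPres R).FullSubcategory

/-- Indecomposable (in particular nonzero) maximal Cohen-Macaulay modules not isomorphic to `R`. -/
structure IndecCM where
  toCM : CM R
  indecomposable : Indecomposable toCM.obj
  not_iso_self : IsEmpty (toCM.obj ≅ ModuleCat.of R R)

/-- Isomorphism of `R`-modules. -/
instance isoSetoid : Setoid (IndecCM R) where
  r M N := Nonempty (M.1.obj ≅ N.1.obj)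
  iseqv := ⟨fun _ => ⟨Iso.refl _⟩, fun ⟨e⟩ => ⟨e.symm⟩, fun ⟨e⟩ ⟨f⟩ => ⟨e ≪≫ f⟩⟩

/-- The set of isomorphism classes of indecomposable maximal Cohen-Macaulay modules other than
`R`. -/
def Sp := _root_.Quotient (isoSetoid R)

variable {R}

/-- The isomorphism class of a module. -/
def Sp.mk (M : IndecCM R) : Sp R := Quotient.mk (isoSetoid R) M

theorem isZero_congr (F : ModStable R) {M N : IndecCM R} (e : M ≈ N) :
    IsZero (F.obj.obj (op ((stableFunctor R).obj M.1))) =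
      IsZero (F.obj.obj (op ((stableFunctor R).obj N.1))) := by
  obtain ⟨e⟩ := e
  exact propext (Iso.isZero_iff (F.obj.mapIso ((stableFunctor R).mapIso
    ((IsMCM R).isoMk e)).op).symm)

/-- `F(M) = 0`, for the isomorphism class `x` of `M`. -/
def Vanishes (F : ModStable R) (x : Sp R) : Prop :=
  _root_.Quotient.liftOn x (fun M => IsZero (F.obj.obj (op ((stableFunctor R).obj M.1))))
    fun _ _ e => isZero_congr F e

/-- `Σ(X)`: the functors that vanish on `X`. -/
def sigma (X : Set (Sp R)) : Set (ModStable R) := {F | ∀ x ∈ X, Vanishes F x}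

/-- `γ(𝓕)`: the points at which all functors in `𝓕` vanish. -/
def gamma (𝓕 : Set (ModStable R)) : Set (Sp R) := {x | ∀ F ∈ 𝓕, Vanishes F x}

theorem isMCM_of_iso {M N : ModuleCat.{u} R} (e : M ≅ N) (h : IsMCM R M) : IsMCM R N := by
  refine ⟨?_, fun i hi => ?_⟩
  · have := h.1
    exact Module.Finite.equiv e.toLinearEquiv
  · have := h.2 i hi
    refine ⟨fun x y => ?_⟩
    have key : ∀ z : Abelian.Ext (ModuleCat.of R (ResidueField R)) N i, z = 0 := fun z => by
      have h1 : z.comp (Abelian.Ext.mk₀ e.inv) (add_zero i) = 0 := Subsingleton.elim _ _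
      have h2 := congrArg (fun w => w.comp (Abelian.Ext.mk₀ e.hom) (add_zero i)) h1
      simpa using h2
    rw [key x, key y]

theorem isMCM_X₁ [IsNoetherianRing R] {S : ShortComplex (ModuleCat.{u} R)} (hS : S.ShortExact)
    (h₂ : IsMCM R S.X₂) (h₃ : IsMCM R S.X₃) : IsMCM R S.X₁ := by
  refine ⟨?_, fun i hi => ?_⟩
  · have := h₂.1
    exact Module.Finite.of_injective S.f.hom hS.moduleCat_injective_f
  · have := h₂.2 i hi
    suffices key : ∀ z : Abelian.Ext (ModuleCat.of R (ResidueField R)) S.X₁ i, z = 0 from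
      ⟨fun x y => by rw [key x, key y]⟩
    intro z
    cases i with
    | zero =>
      have := hS.mono_f
      apply Abelian.Ext.postcomp_mk₀_injective_of_mono _ S.f
      exact Subsingleton.elim _ _
    | succ j =>
      obtain ⟨w, rfl⟩ := Abelian.Ext.covariant_sequence_exact₁ _ hS z (Subsingleton.elim _ _) rfl
      have := h₃.2 j (lt_trans (by exact_mod_cast Nat.lt_succ_self j) hi)
      rw [Subsingleton.elim w 0, Abelian.Ext.zero_comp]

theorem isMCM_X₂ {S : ShortComplex (ModuleCat.{u} R)} (hS : S.ShortExact)
    (h₁ : IsMCM R S.X₁) (h₃ : IsMCM R S.X₃) : IsMCM R S.X₂ := by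
  refine ⟨?_, fun i hi => ?_⟩
  · have := h₁.1
    have := h₃.1
    exact Module.Finite.of_exact (f := S.f.hom) (g := S.g.hom) 
      ((ShortComplex.ShortExact.moduleCat_exact_iff_function_exact S).1 hS.exact)
      hS.moduleCat_surjective_g
  · have := h₁.2 i hi
    have := h₃.2 i hi
    suffices key : ∀ z : Abelian.Ext (ModuleCat.of R (ResidueField R)) S.X₂ i, z = 0 from
      ⟨fun x y => by rw [key x, key y]⟩
    intro z
    obtain ⟨w, rfl⟩ := Abelian.Ext.covariant_sequence_exact₂ _ hS z (Subsingleton.elim _ _)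
    rw [Subsingleton.elim w 0, Abelian.Ext.zero_comp]

theorem isMCM_prod (M N : ModuleCat.{u} R) (hM : IsMCM R M) (hN : IsMCM R N) :
    IsMCM R (ModuleCat.of R (M × N)) :=
  isMCM_X₂ (S := ModuleCat.shortComplexOfCompEqZero (LinearMap.inl R M N) (LinearMap.snd R M N)
    (by ext; simp))
    (ModuleCat.shortComplex_shortExact _ Function.Exact.inl_snd LinearMap.inl_injective
      LinearMap.snd_surjective) hM hN

theorem isMCM_pi [IsCohenMacaulay R] (n : ℕ) : IsMCM R (ModuleCat.of R (Fin n → R)) := by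
  induction n with
  | zero =>
    refine ⟨inferInstanceAs (Module.Finite R (Fin 0 → R)), fun i _ => ?_⟩
    have : IsZero (ModuleCat.of R (Fin 0 → R)) := ModuleCat.isZero_of_subsingleton _
    refine ⟨fun x y => ?_⟩
    rw [← Abelian.Ext.comp_mk₀_id x, ← Abelian.Ext.comp_mk₀_id y, this.eq_of_src (𝟙 _) 0]
    simp
  | succ n ih =>
    exact isMCM_of_iso (Fin.consLinearEquiv R (fun _ : Fin (n + 1) => R)).toModuleIso
      (isMCM_prod _ _ IsCohenMacaulay.isMCM_self ih)

theorem isMCM_ker [IsNoetherianRing R] {M N : ModuleCat.{u} R} (φ : M →ₗ[R] N) (hφ : Function.Surjective φ)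
    (hM : IsMCM R M) (hN : IsMCM R N) : IsMCM R (ModuleCat.of R (LinearMap.ker φ)) :=
  isMCM_X₁ (LinearMap.shortExact_shortComplexKer hφ) hM hN

end
section
variable {R : Type u} [CommRing R]

theorem isPrecomplete_of_finite (I : Ideal R) [IsPrecomplete I R] (M : Type u) [AddCommGroup M]
    [Module R M] [Module.Finite R M] : IsPrecomplete I M := by
  rw [← AdicCompletion.of_surjective_iff]
  intro y
  obtain ⟨t, rfl⟩ := AdicCompletion.ofTensorProduct_surjective_of_finite I M y
  induction t using TensorProduct.induction_on with
  | zero => exact ⟨0, by simp⟩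
  | tmul r x =>
    obtain ⟨s, rfl⟩ := AdicCompletion.of_surjective I R r
    refine ⟨s • x, ?_⟩
    rw [AdicCompletion.ofTensorProduct_tmul, map_smul]
    ext n
    rfl
  | add a b ha hb =>
    obtain ⟨a', ha⟩ := ha
    obtain ⟨b', hb⟩ := hb
    exact ⟨a' + b', by rw [map_add, map_add, ha, hb]⟩

theorem exists_idempotent_of_finite [IsNoetherianRing R] [IsLocalRing R]
    [IsAdicComplete (maximalIdeal R) R] {A : Type u} [CommRing A] [Algebra R A] [Module.Finite R A]
    (x : A) : ∃ e : A, e * e = e ∧ (e = 0 → IsUnit (1 - x)) ∧ (e = 1 → IsUnit x) := by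
  let J : Ideal A := (maximalIdeal R).map (algebraMap R A)
  have : IsPrecomplete (maximalIdeal R) A := isPrecomplete_of_finite _ _
  have : IsPrecomplete J A := IsPrecomplete.map_algebraMap_iff.2 ‹_›
  have : IsHausdorff J A := IsHausdorff.map_algebraMap_iff.2 inferInstance
  have : IsAdicComplete J A := ⟨⟩
  have hJ := IsAdicComplete.le_jacobson_bot (R := A) J
  have hloc : IsLocalHom (Ideal.Quotient.mk J) := isLocalHom_of_le_jacobson_bot J hJ
  have hart : IsArtinianRing (A ⧸ J) := by
    let : Algebra (R ⧸ maximalIdeal R) (A ⧸ J) :=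
      Ideal.Quotient.algebraQuotientOfLEComap Ideal.le_comap_map
    have : IsScalarTower R (R ⧸ maximalIdeal R) (A ⧸ J) :=
      IsScalarTower.of_algebraMap_eq fun _ => rfl
    have : Module.Finite (R ⧸ maximalIdeal R) (A ⧸ J) :=
      Module.Finite.of_restrictScalars_finite R _ _
    let : Field (R ⧸ maximalIdeal R) := Ideal.Quotient.field _
    exact IsArtinianRing.of_finite (R ⧸ maximalIdeal R) _
  obtain ⟨n, hn⟩ := IsArtinian.range_smul_pow_stabilizes (R := A ⧸ J) (A ⧸ J)
    (Ideal.Quotient.mk J x)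
  obtain ⟨y, hy⟩ : ∃ y : A, Ideal.Quotient.mk J (x ^ (n + 1)) =
      Ideal.Quotient.mk J (x ^ (n + 1) * x ^ (n + 1) * y) := by
    have h1 := (hn (n + 1) (by omega)).symm.trans (hn (2 * n + 2) (by omega))
    have h2 : (Ideal.Quotient.mk J x) ^ (n + 1) ∈
        LinearMap.range ((Ideal.Quotient.mk J x) ^ (n + 1) •
          (LinearMap.id : A ⧸ J →ₗ[A ⧸ J] A ⧸ J)) := ⟨1, by simp⟩
    rw [h1] at h2
    obtain ⟨z, hz⟩ := h2
    obtain ⟨y, rfl⟩ := Ideal.Quotient.mk_surjective z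
    refine ⟨y, ?_⟩
    rw [map_mul, map_mul, map_pow, ← pow_add, ← two_mul, mul_add, ← smul_eq_mul]
    exact hz.symm
  let a := x ^ (n + 1) * y
  have ha : Ideal.Quotient.mk J (a * a) = Ideal.Quotient.mk J a := by
    simp only [a]
    rw [show x ^ (n + 1) * y * (x ^ (n + 1) * y) = x ^ (n + 1) * x ^ (n + 1) * y * y by ring,
      map_mul, ← hy, ← map_mul]
  obtain ⟨e, he, hea⟩ := HenselianRing.is_henselian (R := A) (I := J)
    (Polynomial.X ^ 2 - Polynomial.X) (by monicity!) a
    (by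
      rw [Polynomial.eval_sub, Polynomial.eval_pow, Polynomial.eval_X, pow_two]
      exact Ideal.Quotient.eq.1 ha)
    (by
      apply IsUnit.of_mul_eq_one (Ideal.Quotient.mk J (2 * a - 1))
      simp only [map_mul, map_sub, map_one, map_ofNat] at ha ⊢
      simp
      linear_combination 4 * ha)
  have hea' := Ideal.Quotient.eq.2 hea
  refine ⟨e, ?_, fun h => ?_, fun h => ?_⟩
  · simp [pow_two, sub_eq_zero] at he
    exact he
  · have : Ideal.Quotient.mk J x ^ (n + 1) = 0 := by
      rw [← map_pow, hy, mul_assoc, map_mul]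
      change _ * Ideal.Quotient.mk J a = 0
      rw [← hea', h, map_zero, mul_zero]
    apply hloc.map_nonunit
    rw [map_sub, map_one]
    exact IsNilpotent.isUnit_one_sub ⟨_, this⟩
  · apply hloc.map_nonunit
    rw [h] at hea'
    apply IsUnit.of_mul_eq_one (Ideal.Quotient.mk J (x ^ n * y))
    rw [← map_mul, ← map_one (Ideal.Quotient.mk J), hea']
    simp only [a]
    congr 1
    ring

theorem isLocalRing_end [IsNoetherianRing R] [IsLocalRing R] [IsAdicComplete (maximalIdeal R) R]
    (M : Type u) [AddCommGroup M] [Module R M] [Module.Finite R M] [Nontrivial M]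
    (hM : ∀ e : Module.End R M, e * e = e → e = 0 ∨ e = 1) : IsLocalRing (Module.End R M) := by
  refine ⟨fun {φ b} h => ?_⟩
  obtain rfl : b = 1 - φ := by rw [← h]; abel
  let ψ : Polynomial R →ₐ[R] Module.End R M := Polynomial.aeval φ
  let ι := Ideal.kerLiftAlg ψ
  have hι : Function.Injective ι := Ideal.kerLiftAlg_injective _
  have : Module.Finite R (Polynomial R ⧸ RingHom.ker ψ) :=
    Module.Finite.of_injective ι.toLinearMap hι
  have hx : ι (Ideal.Quotient.mk _ Polynomial.X) = φ := by
    rw [Ideal.kerLiftAlg_mk]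
    exact Polynomial.aeval_X φ
  obtain ⟨e, he, h0, h1⟩ := exists_idempotent_of_finite (R := R)
    (Ideal.Quotient.mk (RingHom.ker ψ) Polynomial.X)
  rcases hM (ι e) (by rw [← map_mul, he]) with h | h
  · right
    have := (h0 (hι (by rw [h, map_zero]))).map ι
    rwa [map_sub, map_one, hx] at this
  · left
    have := (h1 (hι (by rw [h, map_one]))).map ι
    rwa [hx] at this
end

section
variable {R : Type u} [CommRing R] [IsLocalRing R]

theorem not_isZero (M : IndecCM R) : Nontrivial M.1.obj := by
  by_contra h
  rw [not_nontrivial_iff_subsingleton] at h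
  exact M.2.1 (ModuleCat.isZero_of_subsingleton _)

theorem subsingleton_or (M : IndecCM R) {Y Z : Type u} [AddCommGroup Y] [Module R Y]
    [AddCommGroup Z] [Module R Z] (e : M.1.obj ≃ₗ[R] (Y × Z)) : Subsingleton Y ∨ Subsingleton Z := by
  have := M.2.2 (ModuleCat.of R Y) (ModuleCat.of R Z)
    (e.toModuleIso ≪≫ (ModuleCat.biprodIsoProd (ModuleCat.of R Y) (ModuleCat.of R Z)).symm)
  exact this.imp (fun h => ModuleCat.subsingleton_of_isZero h) fun h => ModuleCat.subsingleton_of_isZero h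

theorem isLocalRing_end_indec [IsNoetherianRing R] [IsAdicComplete (maximalIdeal R) R] (M : IndecCM R) :
    IsLocalRing (Module.End R M.1.obj) := by
  have := not_isZero M
  have := M.1.property.1
  apply isLocalRing_end
  intro e he
  have hc := LinearMap.IsIdempotentElem.isCompl (f := e) he
  rcases subsingleton_or M (Submodule.prodEquivOfIsCompl _ _ hc).symm with h | h
  · left
    exact LinearMap.range_eq_bot.1 ((Submodule.subsingleton_iff_eq_bot).1 h)
  · right
    have hk := (Submodule.subsingleton_iff_eq_bot).1 h
    ext x
    have : e x - x ∈ LinearMap.ker e := by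
      rw [LinearMap.mem_ker, map_sub, sub_eq_zero]
      exact congrArg (fun g : Module.End R M.1.obj => g x) he
    rw [hk] at this
    exact sub_eq_zero.1 this

theorem not_retract_of_free [IsNoetherianRing R] (M : IndecCM R) (P : ModuleCat.{u} R) [Module.Finite R P]
    [Module.Free R P] (a : M.1.obj ⟶ P) (b : P ⟶ M.1.obj) (h : a ≫ b = 𝟙 _) : False := by
  have hab : b.hom ∘ₗ a.hom = LinearMap.id := by rw [← ModuleCat.hom_comp, h]; rfl
  have := M.1.property.1
  have : Module.Projective R M.1.obj := Module.Projective.of_split a.hom b.hom hab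
  have : Module.Free R M.1.obj := Module.free_of_flat_of_isLocalRing
  have e := (Module.finBasis R M.1.obj).equivFun
  generalize Module.finrank R M.1.obj = n at e
  cases n with
  | zero =>
    have := not_isZero M
    have := e.symm.toEquiv.nontrivial
    exact not_subsingleton (Fin 0 → R) inferInstance
  | succ n =>
    rcases subsingleton_or M (e.trans (Fin.consLinearEquiv R (fun _ : Fin (n + 1) => R)).symm) with h | h
    · exact not_subsingleton R h
    · cases n with
      | zero =>
        exact M.3.false (e.trans (LinearEquiv.funUnique (Fin 1) R R)).toModuleIso
      | succ n => exact not_subsingleton (Fin (n + 1) → R) h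

theorem exact_cokernel {B A : StableCM R} (f : B ⟶ A) (X : (StableCM R)ᵒᵖ) :
    Function.Exact ((preadditiveYoneda.map f).app X)
      ((cokernel.π (preadditiveYoneda.map f)).app X) ∧
    Function.Surjective ((cokernel.π (preadditiveYoneda.map f)).app X) := by
  constructor
  · have h := ShortComplex.exact_cokernel (preadditiveYoneda.map f)
    have h' := h.map ((evaluation _ _).obj X)
    exact (ShortComplex.ab_exact_iff_function_exact _).1 h'
  · rw [← AddCommGrpCat.epi_iff_surjective]
    infer_instance

theorem isFinPres_cokernel {B A : StableCM R} (f : B ⟶ A) :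
    IsFinPres R (cokernel (preadditiveYoneda.map f)) := by
  refine ⟨⟨fun {X Y g h} => ?_⟩, B, A, f, cokernel.π _, exact_cokernel f⟩
  have := (exact_cokernel f X).2
  ext x
  obtain ⟨x, rfl⟩ := this x
  have nat : ∀ k : X ⟶ Y, (cokernel (preadditiveYoneda.map f)).map k
      ((cokernel.π (preadditiveYoneda.map f)).app X x) =
      (cokernel.π (preadditiveYoneda.map f)).app Y ((preadditiveYoneda.obj A).map k x) :=
    fun k => (NatTrans.naturality_apply (cokernel.π (preadditiveYoneda.map f)) k x).symm
  rw [AddCommGrpCat.hom_add_apply]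
  rw [nat, nat, nat, Functor.map_add, ← map_add]
  rfl

theorem map_stable_eq_iff {M N : CM R} (f g : M ⟶ N) :
    (stableFunctor R).map f = (stableFunctor R).map g ↔ stableRel R f g :=
  CategoryTheory.Quotient.functor_map_eq_iff _ _ _

theorem map_stable_surjective {M N : CM R} (f : (stableFunctor R).obj M ⟶ (stableFunctor R).obj N) :
    ∃ g : M ⟶ N, (stableFunctor R).map g = f :=
  (CategoryTheory.Quotient.functor (stableRel R)).map_surjective f

theorem vanishes_mk (F : ModStable R) (M : IndecCM R) : Vanishes F (Sp.mk M) ↔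
    ∀ y : F.obj.obj (op ((stableFunctor R).obj M.1)), y = 0 := by
  change IsZero _ ↔ _
  rw [AddCommGrpCat.isZero_iff_subsingleton]
  exact ⟨fun _ y => Subsingleton.elim _ _, fun h => ⟨fun x y => by rw [h x, h y]⟩⟩

theorem exists_map_of_notMem_closure [IsNoetherianRing R] [IsCohenMacaulay R] (X : Set (Sp R)) (M : IndecCM R)
    (h : Sp.mk M ∉ gamma (sigma X)) :
    ∃ (K : CM R) (p : K ⟶ M.1), (∀ N : IndecCM R, Sp.mk N ∈ X → ∀ h : N.1 ⟶ M.1,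
      ∃ u : N.1 ⟶ K, u ≫ p = h) ∧ ∀ u : M.1 ⟶ K, u ≫ p ≠ 𝟙 _ := by
  simp only [gamma, Set.mem_ofPred_eq, not_forall] at h
  obtain ⟨F, hF, hFM⟩ := h
  obtain ⟨hadd, B, A, f, π, hπ⟩ := F.property
  obtain ⟨B, rfl⟩ : ∃ B', B = (stableFunctor R).obj B' := ⟨B.as, rfl⟩
  obtain ⟨A, rfl⟩ : ∃ A', A = (stableFunctor R).obj A' := ⟨A.as, rfl⟩
  obtain ⟨β, rfl⟩ := map_stable_surjective f
  rw [vanishes_mk, not_forall] at hFM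
  obtain ⟨y, hy⟩ := hFM
  obtain ⟨a, rfl⟩ := (hπ _).2 y
  obtain ⟨a, rfl⟩ : ∃ a' : M.1 ⟶ A, (stableFunctor R).map a' = a := map_stable_surjective a
  have := A.property.1
  obtain ⟨n, θ, hθ⟩ := Module.Finite.exists_fin' R A.obj
  let φ : ((M.1.obj × B.obj) × (Fin n → R)) →ₗ[R] A.obj :=
    (a.hom.hom.coprod (-β.hom.hom)).coprod (-θ)
  have hφ : Function.Surjective φ := fun x => by
    obtain ⟨z, rfl⟩ := hθ x
    exact ⟨((0, 0), -z), by simp [φ]⟩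
  let K : CM R := ⟨ModuleCat.of R (LinearMap.ker φ),
    isMCM_ker (M := ModuleCat.of R ((M.1.obj × B.obj) × (Fin n → R))) φ hφ
      (isMCM_prod (ModuleCat.of R (M.1.obj × B.obj)) _
        (isMCM_prod _ _ M.1.property B.property) (isMCM_pi n)) A.property⟩
  let p : K ⟶ M.1 := ObjectProperty.homMk (ModuleCat.ofHom
    (LinearMap.fst R _ _ ∘ₗ LinearMap.fst R _ _ ∘ₗ (LinearMap.ker φ).subtype))
  refine ⟨K, p, fun N hN h => ?_, fun u hu => hy ?_⟩
  · have h0 := (vanishes_mk F N).1 (hF _ hN)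
    obtain ⟨b, hb⟩ := ((hπ (op ((stableFunctor R).obj N.1))).1 ((stableFunctor R).map (h ≫ a))).1 (h0 _)
    obtain ⟨b, rfl⟩ : ∃ b' : N.1 ⟶ B, (stableFunctor R).map b' = b := map_stable_surjective b
    have hb' : (stableFunctor R).map (h ≫ a) = (stableFunctor R).map (b ≫ β) := by
      rw [← hb, Functor.map_comp]
      rfl
    rw [map_stable_eq_iff] at hb'
    obtain ⟨P, _, _, c, d, hcd⟩ := hb'
    obtain ⟨l, hl⟩ := Module.projective_lifting_property θ d.hom hθ
    have key : ∀ x, a.hom (h.hom x) - β.hom (b.hom x) = θ (l (c.hom x)) := fun x => by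
      have h1 := congrArg (fun g => ModuleCat.Hom.hom g x) hcd
      have h2 := congrArg (fun g => g (c.hom x)) hl
      exact h1.trans h2.symm
    refine ⟨ObjectProperty.homMk (ModuleCat.ofHom (LinearMap.codRestrict (LinearMap.ker φ)
      ((h.hom.hom.prod b.hom.hom).prod (l ∘ₗ c.hom)) fun x => ?_)), ?_⟩
    · change a.hom.hom (h.hom.hom x) + -β.hom.hom (b.hom.hom x) + -θ (l (c.hom x)) = 0
      rw [← key x]
      change a.hom.hom (h.hom.hom x) + -β.hom.hom (b.hom.hom x) +
        -(a.hom.hom (h.hom.hom x) - β.hom.hom (b.hom.hom x)) = 0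
      abel
    · ext x
      rfl
  · let b : M.1 ⟶ B := ObjectProperty.homMk (ModuleCat.ofHom
      (LinearMap.snd R _ _ ∘ₗ LinearMap.fst R _ _ ∘ₗ (LinearMap.ker φ).subtype ∘ₗ u.hom.hom))
    have hab : (stableFunctor R).map a = (stableFunctor R).map (b ≫ β) := by
      rw [map_stable_eq_iff]
      refine ⟨ModuleCat.of R (Fin n → R), inferInstanceAs (Module.Finite R (Fin n → R)),
        inferInstanceAs (Module.Free R (Fin n → R)), ModuleCat.ofHom
        (LinearMap.snd R _ _ ∘ₗ (LinearMap.ker φ).subtype ∘ₗ u.hom.hom), ModuleCat.ofHom θ, ?_⟩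
      ext x
      have h1 : φ (u.hom.hom x).1 = 0 := (u.hom.hom x).2
      have h2 : (u.hom.hom x).1.1.1 = x := congrArg (fun g => ModuleCat.Hom.hom g.hom x) hu
      simp only [φ, LinearMap.coprod_apply, LinearMap.neg_apply, h2] at h1
      change a.hom.hom x - β.hom.hom ((u.hom.hom x).1.1.2) = θ (u.hom.hom x).1.2
      rw [← sub_eq_zero, ← h1]
      abel
    rw [hab, Functor.map_comp]
    exact ((hπ _).1 _).2 ⟨(stableFunctor R).map b, rfl⟩

theorem notMem_closure_of_map [IsNoetherianRing R] [IsAdicComplete (maximalIdeal R) R]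
    (X : Set (Sp R)) (M : IndecCM R) (K : CM R) (p : K ⟶ M.1)
    (hp : ∀ N : IndecCM R, Sp.mk N ∈ X → ∀ h : N.1 ⟶ M.1, ∃ u : N.1 ⟶ K, u ≫ p = h)
    (hM : ∀ u : M.1 ⟶ K, u ≫ p ≠ 𝟙 _) : Sp.mk M ∉ gamma (sigma X) := by
  have := isLocalRing_end_indec M
  let F : ModStable R := ⟨_, isFinPres_cokernel ((stableFunctor R).map p)⟩
  have hF := exact_cokernel ((stableFunctor R).map p)
  intro h
  have hFM : Vanishes F (Sp.mk M) := h F fun x hx => by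
    obtain ⟨N, rfl⟩ := Quotient.exists_rep x
    refine (vanishes_mk F N).2 fun y => ?_
    obtain ⟨y, rfl⟩ := (hF _).2 y
    obtain ⟨g, rfl⟩ : ∃ g : N.1 ⟶ M.1, (stableFunctor R).map g = y := map_stable_surjective y
    obtain ⟨u, rfl⟩ := hp N hx g
    rw [Functor.map_comp]
    exact ((hF _).1 _).2 ⟨(stableFunctor R).map u, rfl⟩
  rw [vanishes_mk] at hFM
  obtain ⟨u, hu⟩ := ((hF _).1 ((stableFunctor R).map (𝟙 M.1))).1 (hFM _)
  obtain ⟨u, rfl⟩ : ∃ g : M.1 ⟶ K, (stableFunctor R).map g = u := map_stable_surjective u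
  have hu' : (stableFunctor R).map (𝟙 M.1) = (stableFunctor R).map (u ≫ p) := by
    rw [← hu, Functor.map_comp]
    rfl
  rw [map_stable_eq_iff] at hu'
  obtain ⟨P, _, _, a, b, hab⟩ := hu'
  have h1 : (u ≫ p).hom.hom + (a ≫ b).hom = (1 : Module.End R M.1.obj) := by
    rw [← hab]
    ext x
    simp
  rcases IsLocalRing.isUnit_or_isUnit_of_add_one h1 with h | h
  · obtain ⟨v, hv⟩ := h.exists_right_inv
    apply hM (ObjectProperty.homMk (ModuleCat.ofHom v) ≫ u)
    ext x
    exact congrArg (fun g : Module.End R M.1.obj => g x) hv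
  · obtain ⟨v, hv⟩ := h.exists_right_inv
    apply not_retract_of_free M P (ModuleCat.ofHom v ≫ a) b
    ext x
    exact congrArg (fun g : Module.End R M.1.obj => g x) hv

theorem subset_closure (X : Set (Sp R)) : X ⊆ gamma (sigma X) := fun _ hx _ hF => hF _ hx

theorem closure_mono {X Y : Set (Sp R)} (h : X ⊆ Y) : gamma (sigma X) ⊆ gamma (sigma Y) :=
  fun _ hx F hF => hx F fun y hy => hF y (h hy)

theorem closure_empty [IsNoetherianRing R] [IsAdicComplete (maximalIdeal R) R] : gamma (sigma (∅ : Set (Sp R))) = ∅ := by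
  refine Set.eq_empty_of_forall_notMem fun x => ?_
  obtain ⟨M, rfl⟩ := Quotient.exists_rep x
  refine notMem_closure_of_map _ M M.1 0 (fun N hN => hN.elim) fun u hu => ?_
  rw [comp_zero] at hu
  exact M.2.1 ((IsZero.iff_id_eq_zero _).2 (congrArg (fun g => g.hom) hu).symm)

theorem closure_union [IsNoetherianRing R] [IsCohenMacaulay R] [IsAdicComplete (maximalIdeal R) R] (X Y : Set (Sp R)) :
    gamma (sigma (X ∪ Y)) = gamma (sigma X) ∪ gamma (sigma Y) := by
  refine Set.Subset.antisymm (fun x hx => ?_) (Set.union_subset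
    (closure_mono Set.subset_union_left) (closure_mono Set.subset_union_right))
  by_contra hxy
  rw [Set.mem_union, not_or] at hxy
  obtain ⟨M, rfl⟩ := Quotient.exists_rep x
  obtain ⟨K, p, hp, hpM⟩ := exists_map_of_notMem_closure X M hxy.1
  obtain ⟨L, q, hq, hqM⟩ := exists_map_of_notMem_closure Y M hxy.2
  refine notMem_closure_of_map (X ∪ Y) M ⟨_, isMCM_prod _ _ K.property L.property⟩
    (ObjectProperty.homMk (ModuleCat.ofHom (p.hom.hom.coprod q.hom.hom))) ?_ ?_ hx
  · rintro N (hN | hN) h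
    · obtain ⟨u, rfl⟩ := hp N hN h
      refine ⟨ObjectProperty.homMk (ModuleCat.ofHom (LinearMap.inl R _ _ ∘ₗ u.hom.hom)), ?_⟩
      ext x
      simp
    · obtain ⟨u, rfl⟩ := hq N hN h
      refine ⟨ObjectProperty.homMk (ModuleCat.ofHom (LinearMap.inr R _ _ ∘ₗ u.hom.hom)), ?_⟩
      ext x
      simp
  · intro u hu
    have := isLocalRing_end_indec M
    let u₁ : M.1.obj →ₗ[R] K.obj := LinearMap.fst R _ _ ∘ₗ u.hom.hom
    let u₂ : M.1.obj →ₗ[R] L.obj := LinearMap.snd R _ _ ∘ₗ u.hom.hom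
    have h1 : p.hom.hom ∘ₗ u₁ + q.hom.hom ∘ₗ u₂ = (1 : Module.End R M.1.obj) := by
      ext x
      exact congrArg (fun g => ModuleCat.Hom.hom g.hom x) hu
    rcases IsLocalRing.isUnit_or_isUnit_of_add_one h1 with h | h
    · obtain ⟨v, hv⟩ := h.exists_right_inv
      apply hpM (ObjectProperty.homMk (ModuleCat.ofHom (u₁ ∘ₗ v)))
      ext x
      exact congrArg (fun g : Module.End R M.1.obj => g x) hv
    · obtain ⟨v, hv⟩ := h.exists_right_inv
      apply hqM (ObjectProperty.homMk (ModuleCat.ofHom (u₂ ∘ₗ v)))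
      ext x
      exact congrArg (fun g : Module.End R M.1.obj => g x) hv

/-- The topology on `Sp CM(R)` whose closed sets are the sets `X` with `γ (Σ X) = X`. -/
instance zieglerTopology [IsNoetherianRing R] [IsCohenMacaulay R]
    [IsAdicComplete (maximalIdeal R) R] : TopologicalSpace (Sp R) :=
  TopologicalSpace.ofClosed {X | gamma (sigma X) = X} closure_empty
    (fun A hA => Set.Subset.antisymm
      (Set.subset_sInter fun X hX => (closure_mono (Set.sInter_subset_of_mem hX)).trans (hA hX).subset)
      (subset_closure _))
    fun X hX Y hY => by
      change gamma (sigma (X ∪ Y)) = X ∪ Y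
      rw [closure_union, hX, hY]

theorem isClosed_iff [IsNoetherianRing R] [IsCohenMacaulay R] [IsAdicComplete (maximalIdeal R) R] (X : Set (Sp R)) :
    IsClosed X ↔ gamma (sigma X) = X := by
  rw [← isOpen_compl_iff]
  change gamma (sigma Xᶜᶜ) = Xᶜᶜ ↔ _
  rw [compl_compl]
end

section
variable {R : Type u} [CommRing R] [IsLocalRing R]

/-- Auslander-Reiten sequences in `CM(R)`: non-split short exact sequences `0 → N → E → M → 0` of
maximal Cohen-Macaulay modules with `N` and `M` indecomposable, such that every morphism `L ⟶ M`
with `L` maximal Cohen-Macaulay that is not a split epimorphism factors through `E ⟶ M`. -/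
structure IsARSequence (S : ShortComplex (ModuleCat.{u} R)) : Prop where
  isMCM₁ : IsMCM R S.X₁
  isMCM₂ : IsMCM R S.X₂
  isMCM₃ : IsMCM R S.X₃
  indecomposable₁ : Indecomposable S.X₁
  indecomposable₃ : Indecomposable S.X₃
  shortExact : S.ShortExact
  nonsplit : IsEmpty S.Splitting
  exists_lift : ∀ (L : ModuleCat.{u} R) (q : L ⟶ S.X₃), IsMCM R L → ¬ IsSplitEpi q →
    ∃ h : L ⟶ S.X₂, h ≫ S.g = q
end

end MCM

/-!
A point `M` is isolated iff it does not lie in the closure of the other points, that is, iff some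
morphism `E ⟶ M` from a maximal Cohen-Macaulay module is not a split epimorphism although all
morphisms to `M` from the other points factor through it. As `End M` is local, such a morphism stays
non-split when non-split morphisms to `M` are added as further components. Adding a free cover and,
`End M` being a Noetherian module, enough non-split endomorphisms of `M` makes it right almost
split.

The kernel `K` of a right almost split `E ⟶ M` may be decomposable, but since `K ⟶ E` does not
split, some morphism from `K` to an indecomposable maximal Cohen-Macaulay module (the projection to
a summand of `K`) does not extend to `E`. The pushout of the extension along this morphism is an
Auslander-Reiten sequence.
-/

namespace MCM

section AlmostSplit

variable {C : Type*} [Category* C]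

/-- A morphism `p : E ⟶ M` is right almost split in the full subcategory given by `P` if it is not
a split epimorphism and every morphism `L ⟶ M` with `P L` that is not a split epimorphism factors
through `p`. Neither `E` nor `M` is required to satisfy `P`. -/
structure IsRightAlmostSplit (P : ObjectProperty C) {E M : C} (p : E ⟶ M) : Prop where
  not_isSplitEpi : ¬ IsSplitEpi p
  exists_lift : ∀ ⦃L : C⦄, P L → ∀ q : L ⟶ M, ¬ IsSplitEpi q → ∃ l : L ⟶ E, l ≫ p = q

theorem isSplitEpi_of_comp {L E M : C} (s : L ⟶ E) (p : E ⟶ M) [IsSplitEpi (s ≫ p)] :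
    IsSplitEpi p :=
  ⟨⟨⟨section_ (s ≫ p) ≫ s, by simp⟩⟩⟩

theorem IsRightAlmostSplit.comp_iso {P : ObjectProperty C} {E M M' : C} {p : E ⟶ M}
    (hp : IsRightAlmostSplit P p) (e : M ≅ M') : IsRightAlmostSplit P (p ≫ e.hom) where
  not_isSplitEpi h := hp.not_isSplitEpi ⟨⟨⟨e.hom ≫ section_ (p ≫ e.hom), by
    simp [← cancel_mono e.hom]⟩⟩⟩
  exists_lift L hL q hq := by
    obtain ⟨l, hl⟩ := hp.exists_lift hL (q ≫ e.inv) fun h =>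
      hq ⟨⟨⟨e.inv ≫ section_ (q ≫ e.inv), by simp [← cancel_mono e.inv]⟩⟩⟩
    exact ⟨l, by simp [reassoc_of% hl]⟩

theorem IsRightAlmostSplit.of_comp {P : ObjectProperty C} {E E' M : C} {i : E ⟶ E'} {p : E' ⟶ M}
    (h : IsRightAlmostSplit P (i ≫ p)) (hp : ¬ IsSplitEpi p) : IsRightAlmostSplit P p where
  not_isSplitEpi := hp
  exists_lift _ hL q hq := by
    obtain ⟨l, hl⟩ := h.exists_lift hL q hq
    exact ⟨l ≫ i, by rw [Category.assoc, hl]⟩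

variable [Preadditive C]

theorem isSplitEpi_or_isSplitEpi_of_add_eq_id {M E₁ E₂ : C} [IsLocalRing (End M)]
    {s₁ : M ⟶ E₁} {s₂ : M ⟶ E₂} {p₁ : E₁ ⟶ M} {p₂ : E₂ ⟶ M} (h : s₁ ≫ p₁ + s₂ ≫ p₂ = 𝟙 M) :
    IsSplitEpi p₁ ∨ IsSplitEpi p₂ := by
  have isSplitEpi_of_isUnit {E : C} (s : M ⟶ E) (p : E ⟶ M) (hu : IsUnit (M := End M) (s ≫ p)) :
      IsSplitEpi p := by
    have := (isUnit_iff_isIso (s ≫ p)).1 hu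
    exact isSplitEpi_of_comp s p
  exact (IsLocalRing.isUnit_or_isUnit_of_add_one (R := End M) h).imp
    (isSplitEpi_of_isUnit s₁ p₁) (isSplitEpi_of_isUnit s₂ p₂)

variable [HasBinaryBiproducts C]

theorem not_isSplitEpi_biprod_desc {M E₁ E₂ : C} [IsLocalRing (End M)] {p₁ : E₁ ⟶ M}
    {p₂ : E₂ ⟶ M} (h₁ : ¬ IsSplitEpi p₁) (h₂ : ¬ IsSplitEpi p₂) :
    ¬ IsSplitEpi (biprod.desc p₁ p₂) := by
  intro h
  obtain ⟨s, hs⟩ := (IsSplitEpi.exists_splitEpi (f := biprod.desc p₁ p₂)).some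
  refine (isSplitEpi_or_isSplitEpi_of_add_eq_id (s₁ := s ≫ biprod.fst) (s₂ := s ≫ biprod.snd)
    ?_).elim h₁ h₂
  rw [← hs, biprod.desc_eq, Preadditive.comp_add, Category.assoc, Category.assoc]

theorem exists_lift_of_not_isSplitEpi_endomorphism (S : Type*) [Semiring S] [Linear S C]
    [HasZeroObject C] {P : ObjectProperty C} [P.IsClosedUnderExtensions] {E M : C}
    [IsLocalRing (End M)] [IsNoetherian S (M ⟶ M)] (hE : P E) (hM : P M) (p : E ⟶ M)
    (hp : ¬ IsSplitEpi p) :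
    ∃ (E' : C) (p' : E' ⟶ M) (i : E ⟶ E'), P E' ∧ ¬ IsSplitEpi p' ∧ i ≫ p' = p ∧
      ∀ r : M ⟶ M, ¬ IsSplitEpi r → ∃ l, l ≫ p' = r := by
  obtain ⟨_, ⟨E', p', i, hE', hp', hi, rfl⟩, hmax⟩ :=
    set_has_maximal_iff_noetherian.2 ‹IsNoetherian S (M ⟶ M)›
      {I | ∃ (E' : C) (p' : E' ⟶ M) (i : E ⟶ E'), P E' ∧ ¬ IsSplitEpi p' ∧ i ≫ p' = p ∧
        LinearMap.range (Linear.rightComp S M p') = I} ⟨_, E, p, 𝟙 E, hE, hp, by simp, rfl⟩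
  refine ⟨E', p', i, hE', hp', hi, fun r hr => ?_⟩
  have hle : LinearMap.range (Linear.rightComp S M p') ≤
      LinearMap.range (Linear.rightComp S M (biprod.desc p' r)) := by
    rintro _ ⟨l, rfl⟩
    exact ⟨l ≫ biprod.inl, by simp⟩
  have heq := eq_of_le_of_not_lt hle (hmax _ ⟨_, biprod.desc p' r, i ≫ biprod.inl,
    P.prop_biprod hE' hM, not_isSplitEpi_biprod_desc hp' hr, by simpa using hi, rfl⟩)
  have hr' : r ∈ LinearMap.range (Linear.rightComp S M (biprod.desc p' r)) :=
    ⟨biprod.inr, by simp⟩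
  rwa [← heq] at hr'

end AlmostSplit

section Abelian

variable {C : Type*} [Category* C] [Abelian C]

theorem nonempty_iso_of_isSplitEpi {N M : C} (hN : Indecomposable N) (hM : ¬ IsZero M)
    (q : N ⟶ M) [IsSplitEpi q] : Nonempty (N ≅ M) := by
  let σ := ShortComplex.Splitting.ofExactOfSection _ (ShortComplex.kernelSequence_exact q)
    (section_ q : M ⟶ N) (IsSplitEpi.id q) (inferInstanceAs (Mono (kernel.ι q)))
  have hker : IsZero (kernel q) := (hN.2 _ _ σ.isoBinaryBiproduct).resolve_right hM
  have : Mono q := Preadditive.mono_of_kernel_zero (hker.eq_of_src _ _)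
  have : IsIso q := isIso_of_mono_of_isSplitEpi q
  exact ⟨asIso q⟩

theorem kernelSubobject_lt_kernelSubobject_comp {X Y Z : C} (f : X ⟶ Y) [Epi f] (g : Y ⟶ Z)
    (hg : ¬ Mono g) : kernelSubobject f < kernelSubobject (f ≫ g) := by
  refine (kernelSubobject_comp_le f g).lt_of_not_ge fun hle => hg ?_
  refine Preadditive.mono_of_cancel_zero g fun {W} w hw => ?_
  obtain ⟨V, π, _, v, hv⟩ := surjective_up_to_refinements_of_epi f w
  have hvg : v ≫ f ≫ g = 0 := by rw [← reassoc_of% hv, hw, comp_zero]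
  have hv0 : v ≫ f = 0 := (kernelSubobject_factors_iff f v).1
    (Subobject.factors_of_le v hle (kernelSubobject_factors _ v hvg))
  rw [← cancel_epi π, hv, hv0, comp_zero]

theorem induction_on_indecomposables {P Q : ObjectProperty C} [P.IsStableUnderRetracts]
    (hP : P ≤ isNoetherianObject) (of_isZero : ∀ Y, IsZero Y → Q Y)
    (of_iso_biprod : ∀ Y Y₁ Y₂ : C, (Y ≅ Y₁ ⊞ Y₂) → Q Y₁ → Q Y₂ → Q Y)
    (of_indecomposable : ∀ Y, P Y → Indecomposable Y → Q Y) {L : C} (hL : P L) : Q L := by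
  have : IsNoetherianObject L := ⟨hP L hL⟩
  suffices key : ∀ (K : Subobject L) (Y : C) (a : L ⟶ Y), Epi a → kernelSubobject a = K →
      P Y → Q Y from key _ L (𝟙 L) inferInstance rfl hL
  intro K
  induction K using WellFoundedGT.induction with
  | ind K ih =>
    rintro Y a _ rfl hY
    have of_retract {Z : C} (ρ : Retract Z Y) (hρ : ¬ Mono ρ.r) : Q Z :=
      ih _ (kernelSubobject_lt_kernelSubobject_comp a ρ.r hρ) Z _ (epi_comp _ _) rfl
        (P.prop_of_retract ρ hY)
    by_cases hind : Indecomposable Y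
    · exact of_indecomposable Y hY hind
    by_cases h0 : IsZero Y
    · exact of_isZero Y h0
    obtain ⟨Y₁, Y₂, e, h₁, h₂⟩ : ∃ Y₁ Y₂, ∃ _ : Y ≅ Y₁ ⊞ Y₂, ¬ IsZero Y₁ ∧ ¬ IsZero Y₂ := by
      simpa [Indecomposable, h0] using hind
    have hfst : ¬ Mono (e.hom ≫ biprod.fst) := fun _ =>
      h₂ (.of_mono_eq_zero (biprod.inr ≫ e.inv) (by simp [← cancel_mono (e.hom ≫ biprod.fst)]))
    have hsnd : ¬ Mono (e.hom ≫ biprod.snd) := fun _ =>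
      h₁ (.of_mono_eq_zero (biprod.inl ≫ e.inv) (by simp [← cancel_mono (e.hom ≫ biprod.snd)]))
    exact of_iso_biprod Y Y₁ Y₂ e
      (of_retract ⟨biprod.inl ≫ e.inv, e.hom ≫ biprod.fst, by simp⟩ hfst)
      (of_retract ⟨biprod.inr ≫ e.inv, e.hom ≫ biprod.snd, by simp⟩ hsnd)

theorem IsRightAlmostSplit.of_indecomposable {P : ObjectProperty C} [P.IsStableUnderRetracts]
    (hP : P ≤ isNoetherianObject) {E M : C} {p : E ⟶ M} (hp : ¬ IsSplitEpi p)
    (exists_lift : ∀ Y, P Y → Indecomposable Y → ∀ q : Y ⟶ M, ¬ IsSplitEpi q → ∃ l, l ≫ p = q) :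
    IsRightAlmostSplit P p where
  not_isSplitEpi := hp
  exists_lift L hL := by
    refine induction_on_indecomposables (Q := fun Y => ∀ q : Y ⟶ M, ¬ IsSplitEpi q →
      ∃ l, l ≫ p = q) hP (fun Y hY q _ => ⟨0, hY.eq_of_src _ _⟩) ?_ exists_lift hL
    intro Y Y₁ Y₂ e h₁ h₂ q hq
    have not_isSplitEpi_comp {Z : C} (s : Z ⟶ Y) : ¬ IsSplitEpi (s ≫ q) := fun _ =>
      hq (isSplitEpi_of_comp s q)
    obtain ⟨l₁, hl₁⟩ := h₁ ((biprod.inl ≫ e.inv) ≫ q) (not_isSplitEpi_comp _)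
    obtain ⟨l₂, hl₂⟩ := h₂ ((biprod.inr ≫ e.inv) ≫ q) (not_isSplitEpi_comp _)
    refine ⟨e.hom ≫ biprod.desc l₁ l₂, ?_⟩
    rw [← cancel_epi e.inv]
    ext <;> simp [hl₁, hl₂]

theorem exists_isRightAlmostSplit_of_exists_lift (S : Type*) [Semiring S] [Linear S C]
    {P : ObjectProperty C} [P.IsStableUnderRetracts] [P.IsClosedUnderExtensions]
    (hP : P ≤ isNoetherianObject) {E M : C} [IsLocalRing (End M)] [IsNoetherian S (M ⟶ M)]
    (hE : P E) (hM : P M) (p : E ⟶ M) (hp : ¬ IsSplitEpi p)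
    (exists_lift : ∀ Y, P Y → Indecomposable Y → IsEmpty (Y ≅ M) → ∀ q : Y ⟶ M, ∃ l, l ≫ p = q) :
    ∃ (E' : C) (p' : E' ⟶ M), P E' ∧ IsRightAlmostSplit P p' := by
  obtain ⟨E', p', i, hE', hp', hi, hend⟩ := exists_lift_of_not_isSplitEpi_endomorphism S hE hM p hp
  refine ⟨E', p', hE', .of_indecomposable hP hp' fun Y hY hind q hq => ?_⟩
  rcases isEmpty_or_nonempty (Y ≅ M) with hYM | ⟨⟨e⟩⟩
  · obtain ⟨l, rfl⟩ := exists_lift Y hY hind hYM q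
    exact ⟨l ≫ i, by rw [Category.assoc, hi]⟩
  · obtain ⟨l, hl⟩ := hend (e.inv ≫ q) fun _ => hq (isSplitEpi_of_comp e.inv q)
    exact ⟨e.hom ≫ l, by rw [Category.assoc, hl, e.hom_inv_id_assoc]⟩

theorem exists_indecomposable_not_extend {P : ObjectProperty C} [P.IsStableUnderRetracts]
    (hP : P ≤ isNoetherianObject) {X E : C} (hX : P X) (i : X ⟶ E) (hi : ¬ IsSplitMono i) :
    ∃ (Z : C) (π : X ⟶ Z), P Z ∧ Indecomposable Z ∧ ∀ r : E ⟶ Z, i ≫ r ≠ π := by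
  by_contra! h
  have exists_extension : ∀ π : X ⟶ X, ∃ r, i ≫ r = π := by
    refine induction_on_indecomposables (Q := fun Z => ∀ π : X ⟶ Z, ∃ r, i ≫ r = π) hP
      (fun Z hZ π => ⟨0, hZ.eq_of_tgt _ _⟩) ?_ (fun Z hZ hind π => h Z π hZ hind) hX
    intro Z Z₁ Z₂ e h₁ h₂ π
    obtain ⟨r₁, hr₁⟩ := h₁ (π ≫ e.hom ≫ biprod.fst)
    obtain ⟨r₂, hr₂⟩ := h₂ (π ≫ e.hom ≫ biprod.snd)
    refine ⟨biprod.lift r₁ r₂ ≫ e.inv, ?_⟩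
    rw [← cancel_mono e.hom]
    ext <;> simp [hr₁, hr₂]
  obtain ⟨r, hr⟩ := exists_extension (𝟙 X)
  exact hi ⟨⟨⟨r, hr⟩⟩⟩

/-- The pushout of an extension `0 ⟶ X₁ ⟶ X₂ ⟶ X₃ ⟶ 0` along a morphism `π : X₁ ⟶ Z`, an
extension of `X₃` by `Z` that represents the image of the given one in `Ext¹(X₃, Z)`. -/
noncomputable abbrev pushoutExtension (S : ShortComplex C) {Z : C} (π : S.X₁ ⟶ Z) :
    ShortComplex C :=
  ShortComplex.mk (pushout.inr S.f π) (pushout.desc S.g 0 (by rw [S.zero, comp_zero]))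
    (pushout.inr_desc _ _ _)

theorem inl_pushoutExtension_g (S : ShortComplex C) {Z : C} (π : S.X₁ ⟶ Z) :
    pushout.inl S.f π ≫ (pushoutExtension S π).g = S.g :=
  pushout.inl_desc _ _ _

theorem shortExact_pushoutExtension {S : ShortComplex C} (hS : S.ShortExact) {Z : C}
    (π : S.X₁ ⟶ Z) : (pushoutExtension S π).ShortExact := by
  have := hS.mono_f
  have := hS.epi_g
  have : Epi (pushoutExtension S π).g :=
    epi_of_epi_fac (inl_pushoutExtension_g S π)
  refine .mk' (ShortComplex.exact_of_g_is_cokernel _ ?_) inferInstance this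
  refine CokernelCofork.IsColimit.ofπ' _ _ fun {A} k hk => ?_
  have hk' : S.f ≫ pushout.inl S.f π ≫ k = 0 := by rw [pushout.condition_assoc, hk, comp_zero]
  refine ⟨hS.exact.desc (pushout.inl S.f π ≫ k) hk', pushout.hom_ext ?_ ?_⟩
  · rw [reassoc_of% inl_pushoutExtension_g, hS.exact.g_desc]
  · rw [(pushoutExtension S π).zero_assoc, zero_comp, hk]

theorem isEmpty_splitting_pushoutExtension {S : ShortComplex C} {Z : C} {π : S.X₁ ⟶ Z}
    (hπ : ∀ r : S.X₂ ⟶ Z, S.f ≫ r ≠ π) : IsEmpty (pushoutExtension S π).Splitting where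
  false σ := hπ (pushout.inl S.f π ≫ σ.r) <| by
    have hr : pushout.inr S.f π ≫ σ.r = 𝟙 Z := σ.f_r
    rw [pushout.condition_assoc, hr, Category.comp_id]

theorem isSplitEpi_g_iff_nonempty_splitting {S : ShortComplex C} (hS : S.ShortExact) :
    IsSplitEpi S.g ↔ Nonempty S.Splitting :=
  ⟨fun _ => ⟨.ofExactOfSection S hS.exact (section_ S.g) (IsSplitEpi.id S.g) hS.mono_f⟩,
    fun ⟨σ⟩ => σ.isSplitEpi_g⟩

theorem isSplitMono_f_iff_nonempty_splitting {S : ShortComplex C} (hS : S.ShortExact) :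
    IsSplitMono S.f ↔ Nonempty S.Splitting :=
  ⟨fun _ => ⟨.ofExactOfRetraction S hS.exact (retraction S.f) (IsSplitMono.id S.f) hS.epi_g⟩,
    fun ⟨σ⟩ => σ.isSplitMono_f⟩

theorem exists_isRightAlmostSplit_pushoutExtension {P : ObjectProperty C}
    [P.IsStableUnderRetracts] (hP : P ≤ isNoetherianObject) {S : ShortComplex C}
    (hS : S.ShortExact) (h₁ : P S.X₁) (hg : IsRightAlmostSplit P S.g) :
    ∃ (Z : C) (π : S.X₁ ⟶ Z), P Z ∧ Indecomposable Z ∧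
      IsRightAlmostSplit P (pushoutExtension S π).g := by
  have not_isSplitMono : ¬ IsSplitMono S.f := by
    rw [isSplitMono_f_iff_nonempty_splitting hS, ← isSplitEpi_g_iff_nonempty_splitting hS]
    exact hg.not_isSplitEpi
  obtain ⟨Z, π, hZ, hind, hπ⟩ := exists_indecomposable_not_extend hP h₁ S.f not_isSplitMono
  refine ⟨Z, π, hZ, hind, .of_comp (i := pushout.inl S.f π) ?_ ?_⟩
  · rwa [inl_pushoutExtension_g]
  · rw [isSplitEpi_g_iff_nonempty_splitting (shortExact_pushoutExtension hS π), not_nonempty_iff]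
    exact isEmpty_splitting_pushoutExtension hπ

end Abelian

section MaximalCohenMacaulay

variable {R : Type u} [CommRing R] [IsLocalRing R]

instance : (IsMCM R).IsClosedUnderExtensions where
  prop_X₂_of_shortExact := isMCM_X₂

instance : (IsMCM R).IsStableUnderRetracts where
  of_retract {Y L} ρ hL := by
    refine ⟨?_, fun n hn => ?_⟩
    · have := hL.1
      exact Module.Finite.of_surjective ρ.r.hom fun y => ⟨ρ.i y, by simp [← ModuleCat.comp_apply]⟩
    · have := hL.2 n hn
      refine subsingleton_of_forall_eq 0 fun x => ?_
      have hx : x.comp (Abelian.Ext.mk₀ ρ.i) (add_zero n) = 0 := Subsingleton.elim _ _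
      simpa using congrArg (fun y => y.comp (Abelian.Ext.mk₀ ρ.r) (add_zero n)) hx

theorem IsARSequence.isRightAlmostSplit {S : ShortComplex (ModuleCat.{u} R)}
    (hS : IsARSequence S) : IsRightAlmostSplit (IsMCM R) S.g where
  not_isSplitEpi := by
    rw [isSplitEpi_g_iff_nonempty_splitting hS.shortExact, not_nonempty_iff]
    exact hS.nonsplit
  exists_lift L hL q := hS.exists_lift L q hL

variable [IsNoetherianRing R]

theorem isMCM_le_isNoetherianObject : IsMCM R ≤ isNoetherianObject := fun M hM => by
  have := hM.1
  exact (ModuleCat.subobjectModule M).toOrderEmbedding.wellFoundedGT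

instance (M : CM R) : IsNoetherian R (M.obj ⟶ M.obj) := by
  have := M.property.1
  exact isNoetherian_of_linearEquiv (ModuleCat.homLinearEquiv (S := R)).symm

instance [IsAdicComplete (maximalIdeal R) R] (M : IndecCM R) :
    IsLocalRing (End M.toCM.obj) := by
  have := isLocalRing_end_indec M
  exact RingHom.domain_isLocalRing
    (ModuleCat.endRingEquiv M.toCM.obj : End M.toCM.obj →+* Module.End R M.toCM.obj)

variable [IsCohenMacaulay R]

theorem exists_isMCM_epi_not_isSplitEpi (M : IndecCM R) :
    ∃ (F : ModuleCat.{u} R) (θ : F ⟶ M.toCM.obj), IsMCM R F ∧ Epi θ ∧ ¬ IsSplitEpi θ := by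
  have := M.toCM.property.1
  obtain ⟨n, θ, hθ⟩ := Module.Finite.exists_fin' R M.toCM.obj
  have : Module.Finite R (ModuleCat.of R (Fin n → R)) :=
    inferInstanceAs (Module.Finite R (Fin n → R))
  have : Module.Free R (ModuleCat.of R (Fin n → R)) := inferInstanceAs (Module.Free R (Fin n → R))
  exact ⟨_, ModuleCat.ofHom θ, isMCM_pi n, (ModuleCat.epi_iff_surjective _).2 hθ, fun h =>
    not_retract_of_free M _ (section_ _) _ (IsSplitEpi.id (ModuleCat.ofHom θ))⟩

theorem epi_of_isRightAlmostSplit {M : IndecCM R} {E : ModuleCat.{u} R} {p : E ⟶ M.toCM.obj}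
    (hp : IsRightAlmostSplit (IsMCM R) p) : Epi p := by
  obtain ⟨F, θ, hF, _, hθ⟩ := exists_isMCM_epi_not_isSplitEpi M
  obtain ⟨l, hl⟩ := hp.exists_lift hF θ hθ
  exact epi_of_epi_fac hl

theorem exists_isARSequence_of_isRightAlmostSplit {M : IndecCM R} {E : ModuleCat.{u} R}
    (hE : IsMCM R E) {p : E ⟶ M.toCM.obj} (hp : IsRightAlmostSplit (IsMCM R) p) :
    ∃ S : ShortComplex (ModuleCat.{u} R), IsARSequence S ∧ Nonempty (S.X₃ ≅ M.toCM.obj) := by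
  have := epi_of_isRightAlmostSplit hp
  have hker : (ShortComplex.kernelSequence p).ShortExact :=
    .mk' (ShortComplex.kernelSequence_exact p) inferInstance this
  obtain ⟨Z, π, hZ, hind, hras⟩ := exists_isRightAlmostSplit_pushoutExtension
    isMCM_le_isNoetherianObject hker (isMCM_X₁ hker hE M.toCM.property) hp
  have hS := shortExact_pushoutExtension hker π
  refine ⟨_, ⟨hZ, isMCM_X₂ hS hZ M.toCM.property, M.toCM.property, hind, M.indecomposable, hS, ?_,
    fun L q hL => hras.exists_lift hL q⟩, ⟨Iso.refl _⟩⟩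
  rw [← not_nonempty_iff, ← isSplitEpi_g_iff_nonempty_splitting hS]
  exact hras.not_isSplitEpi

variable [IsAdicComplete (maximalIdeal R) R]

theorem notMem_closure_iff (X : Set (Sp R)) (M : IndecCM R) :
    Sp.mk M ∉ gamma (sigma X) ↔ ∃ (E : ModuleCat.{u} R) (p : E ⟶ M.toCM.obj), IsMCM R E ∧
      ¬ IsSplitEpi p ∧ ∀ N : IndecCM R, Sp.mk N ∈ X → ∀ q : N.toCM.obj ⟶ M.toCM.obj,
        ∃ l, l ≫ p = q := by
  constructor
  · intro h
    obtain ⟨K, p, hp, hpM⟩ := exists_map_of_notMem_closure X M h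
    refine ⟨K.obj, p.hom, K.property, fun ⟨⟨s⟩⟩ => ?_, fun N hN q => ?_⟩
    · exact hpM (ObjectProperty.homMk s.section_) (by ext1; exact s.id)
    · obtain ⟨l, hl⟩ := hp N hN (ObjectProperty.homMk q)
      exact ⟨l.hom, congrArg (·.hom) hl⟩
  · rintro ⟨E, p, hE, hp, hN⟩
    refine notMem_closure_of_map X M ⟨E, hE⟩ (ObjectProperty.homMk p) (fun N hNX q => ?_)
      fun s hs => hp ⟨⟨⟨s.hom, congrArg (·.hom) hs⟩⟩⟩
    obtain ⟨l, hl⟩ := hN N hNX q.hom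
    exact ⟨ObjectProperty.homMk l, by ext1; exact hl⟩

theorem isOpen_singleton_iff_notMem_closure (x : Sp R) :
    IsOpen {x} ↔ x ∉ gamma (sigma {x}ᶜ) := by
  rw [← isClosed_compl_iff, isClosed_iff]
  refine ⟨fun h => by simp [h], fun h => Set.Subset.antisymm ?_ (subset_closure _)⟩
  rintro y hy rfl
  exact h hy

theorem exists_isRightAlmostSplit_of_notMem_closure {M : IndecCM R}
    (h : Sp.mk M ∉ gamma (sigma {Sp.mk M}ᶜ)) :
    ∃ (E : ModuleCat.{u} R) (p : E ⟶ M.toCM.obj), IsMCM R E ∧ IsRightAlmostSplit (IsMCM R) p := by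
  obtain ⟨E, p, hE, hp, hN⟩ := (notMem_closure_iff _ M).1 h
  obtain ⟨F, θ, hF, _, hθ⟩ := exists_isMCM_epi_not_isSplitEpi M
  refine exists_isRightAlmostSplit_of_exists_lift R isMCM_le_isNoetherianObject
    ((IsMCM R).prop_biprod hE hF) M.toCM.property (biprod.desc p θ)
    (not_isSplitEpi_biprod_desc hp hθ) fun Y hY hind hYM q => ?_
  rcases isEmpty_or_nonempty (Y ≅ ModuleCat.of R R) with hYR | ⟨⟨e⟩⟩
  · obtain ⟨l, rfl⟩ := hN ⟨⟨Y, hY⟩, hind, hYR⟩ (fun h => hYM.elim (Quotient.exact h).some) q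
    exact ⟨l ≫ biprod.inl, by simp⟩
  · have : Projective Y := Projective.of_iso e.symm inferInstance
    exact ⟨Projective.factorThru q θ ≫ biprod.inr, by simp⟩

theorem isOpen_singleton_iff_exists_isRightAlmostSplit (M : IndecCM R) :
    IsOpen {Sp.mk M} ↔
      ∃ (E : ModuleCat.{u} R) (p : E ⟶ M.toCM.obj), IsMCM R E ∧ IsRightAlmostSplit (IsMCM R) p := by
  rw [isOpen_singleton_iff_notMem_closure]
  refine ⟨exists_isRightAlmostSplit_of_notMem_closure, fun ⟨E, p, hE, hp⟩ => ?_⟩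
  refine (notMem_closure_iff _ M).2 ⟨E, p, hE, hp.not_isSplitEpi, fun N hN q => ?_⟩
  exact hp.exists_lift N.toCM.property q fun _ =>
    hN (Quotient.sound (nonempty_iso_of_isSplitEpi N.indecomposable M.indecomposable.1 q))

end MaximalCohenMacaulay

end MCM

theorem proposition2p14 {R : Type u} [CommRing R] [IsNoetherianRing R] [IsLocalRing R]
    [IsAdicComplete (IsLocalRing.maximalIdeal R) R] [MCM.IsCohenMacaulay R] (M : MCM.IndecCM R) :
    IsOpen ({MCM.Sp.mk M} : Set (MCM.Sp R)) ↔
      ∃ S : CategoryTheory.ShortComplex (ModuleCat.{u} R),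
        MCM.IsARSequence S ∧ Nonempty (S.X₃ ≅ M.toCM.obj) := by
  rw [MCM.isOpen_singleton_iff_exists_isRightAlmostSplit]
  constructor
  · rintro ⟨E, p, hE, hp⟩
    exact MCM.exists_isARSequence_of_isRightAlmostSplit hE hp
  · rintro ⟨S, hS, ⟨e⟩⟩
    exact ⟨S.X₂, S.g ≫ e.hom, hS.isMCM₂, hS.isRightAlmostSplit.comp_iso e⟩
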